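/- **Setting.** A (finite-horizon) Dec-POMDP $D$ consists of agents $\mathcal N=\{1,\dots,N\}$, finite sets of states $\mathcal S$, actions $\mathcal A_i\neq\emptyset$ and observations $\mathcal O_i$ ($i\in\mathcal N$), with $\mathcal A=\prod_i\mathcal A_i$, $\mathcal O=\prod_i\mathcal O_i$, kernels $P(\cdot\mid s,a)\in\Delta(\mathcal S)$ and $O(\cdot\mid s,a)\in\Delta(\mathcal O)$, a reward $\mathcal R:\mathcal S\times\mathcal A\to\mathbb R$, an initial distribution $b_0\in\Delta(\mathcal S)$ and a horizon $T\in\mathbb N_0$. A local policy of agent $i$ maps each local history $\tau_{i,t}\in(\mathcal A_i\times\mathcal O_i)^t$, $0\le t\le T$, to a distribution $\pi_i(\cdot\mid\tau_{i,t})\in\Delta(\mathcal A_i)$; $\Pi^D=\prod_i\Pi^D_i$ is the set of joint policies, with its Borel $\sigma$-algebra. Under $\mathbb P_\pi$: $S_0\sim b_0$, the agents independently draw $A_{i,t}\sim\pi_i(\cdot\mid \overline{AO}_{i,t})$ with $\overline{AO}_{i,t}=(A_{i,0},O_{i,1},\dots,A_{i,t-1},O_{i,t})$, $S_{t+1}\sim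 P(\cdot\mid S_t,A_t)$, $O_{t+1}\sim O(\cdot\mid S_{t+1},A_t)$; and $J^D(\pi)=\mathbb E_\pi\big[\sum_{t=0}^T\mathcal R(S_t,A_t)\big]$. An isomorphism $f\in\mathrm{Iso}(D,E)$ (for $T^D=T^E$) is a tuple of bijections $f_N:\mathcal N^D\to\mathcal N^E$, $f_S:\mathcal S^D\to\mathcal S^E$, $f_{A_i}:\mathcal A^D_i\to\mathcal A^E_{f_N(i)}$, $f_{O_i}:\mathcal O^D_i\to\mathcal O^E_{f_N(i)}$ that preserves $P,O,\mathcal R,b_0$; $\mathrm{Aut}(D)=\mathrm{Iso}(D,D)$. The pushforward $f^*\pi\in\Pi^E$ of $\pi\in\Pi^D$ is $(f^*\pi)_j(a_j\mid\tau_{j,t})=\pi_{f^{-1}j}(f^{-1}a_j\mid f^{-1}\tau_{j,t})$, and $f^*\nu=\nu\circ(f^*)^{-1}$ for a probability measure $\nu$ on $\Pi^D$. For $\mathbf g\in\mathrm{Aut}(D)^{\mathcal N}$ put $\mathbf g^*\pi=((\mathbf g_i^*\pi)_i)_{i\in\mathcal N}$. The other-play (OP) objective is $J^D_{\mathrm{OP}}(\pi)=|\mathrm{Aut}(D)|^{-N}\sum_{\mathbf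 g\in\mathrm{Aut}(D)^{\mathcal N}}J^D(\mathbf g^*\pi)$, and $\Pi^D_{\mathrm{OP}}=\arg\max_{\pi\in\Pi^D}J^D_{\mathrm{OP}}(\pi)$. The symmetrizer $\Psi^D:\Pi^D\to\Pi^D$ is defined as follows. Let $\mu=|\mathrm{Aut}(D)|^{-N}\sum_{\mathbf g}\delta_{\mathbf g^*\pi}$ with marginals $\mu_i$ on $\Pi^D_i$. Then $\Psi^D(\pi)_i(a_i\mid\tau_{i,t})=\mathbb P_{\mu_i\otimes\mu_{-i}}(A_{i,t}=a_i\mid\overline{AO}_{i,t}=\tau_{i,t})$, where $\mu_{-i}$ is any product of probability measures on the $\Pi^D_j$, $j\ne i$, for which the conditioning event has positive probability (the value does not depend on the choice), and $\Psi^D(\pi)_i(\cdot\mid\tau_{i,t})$ is uniform if there is none; here $\mathbb P_{\mu_i\otimes\mu_{-i}}$ means that a joint policy is first drawn from $\mu_i\otimes\mu_{-i}$ and then followed. Write $\pi\equiv_D\pi'$ if $\Psi^D(\pi)=\Psi^D(\pi')$, $[\pi]$ for the class of $\pi$, and $f^*[\pi]=[f^*\pi]$. A labeling of $D$ is a tuple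 $f$ of bijections $\mathcal N\to\{1,\dots,N\}$, $\mathcal S\to\{1,\dots,|\mathcal S|\}$, $\mathcal A_i\to\{1,\dots,|\mathcal A_i|\}$, $\mathcal O_i\to\{1,\dots,|\mathcal O_i|\}$ ($i\in\mathcal N$), and $f^*D$ is the Dec-POMDP obtained by transporting $D$ along $f$. Let $\mathcal D$ be the finite set of all $f^*D$. A learning algorithm $\sigma\in\Sigma^{\mathcal D}$ assigns to each $E\in\mathcal D$ a probability measure $\sigma(E)$ on $\Pi^E$. The label-free coordination (LFC) game for $D$ has players (principals) $\mathcal N$, strategies $\Sigma^{\mathcal D}$ and common payoff $$U(\boldsymbol\sigma_1,\dots,\boldsymbol\sigma_N)=\mathbb E_{D_i\sim\mathcal U(\mathcal D),\,i\in\mathcal N}\Big[\mathbb E_{f_j\sim\mathcal U(\mathrm{Iso}(D_j,D)),\,j\in\mathcal N}\Big[\mathbb E_{\pi^{(k)}\sim f_k^*\boldsymbol\sigma_k(D_k),\,k\in\mathcal N}\big[J^D\big((\pi^{(l)}_l)_{l\in\mathcal N}\big)\big]\Big]\Big],$$ all draws independent and $\mathcal U$ uniform. Put $U(\sigma)=U(\sigma,\dots,\sigma)$;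 $\sigma$ is optimal in the LFC problem for $D$ if $U(\sigma)\ge U(\sigma')$ for all $\sigma'\in\Sigma^{\mathcal D}$. A profile is symmetric if $\boldsymbol\sigma_i=\boldsymbol\sigma_{g^{-1}i}$ for all $g\in\mathrm{Aut}(D)$, $i\in\mathcal N$, and an optimal symmetric profile is a symmetric profile whose payoff is at least that of every symmetric profile. A tie-breaking function for $\mathcal D$ is a map $\chi$ assigning to each $E\in\mathcal D$ and $\pi\in\Pi^E$ a value $\chi(E,\pi)\in[0,1]$ such that for every $E\in\mathcal D$: (i) $\chi(E,\cdot)$ attains a maximum on $\Pi^E_{\mathrm{OP}}$; (ii) for all $\pi,\pi'\in\Pi^E$, $\chi(E,\pi)=\chi(E,\pi')$ implies $\pi\equiv_E\pi'$. It is invariant to isomorphism if for all $E,F\in\mathcal D$, $f\in\mathrm{Iso}(E,F)$, $\pi\in\Pi^E$, $\pi'\in\Pi^F$, $f^*[\pi]=[\pi']$ implies $\chi(E,\pi)=\chi(F,\pi')$. An OP with tie-breaking learning algorithm for $\chi$ is a $\sigma^\chi\in\Sigma^{\mathcal D}$ such that for every $E\in\mathcal D$ there is a measurable set $\mathcal Z\subseteq\arg\max_{\pi\in\Pi^E_{\mathrm{OP}}}\chi(E,\pi)$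 with $\sigma^\chi(E)(\mathcal Z)=1$. **Theorem.** Let $D$ be a Dec-POMDP, $\chi$ a tie-breaking function for $\mathcal D$ that is invariant to isomorphism, and $\sigma^\chi$ an OP with tie-breaking learning algorithm for $\chi$. Then the profile $(\sigma^\chi,\dots,\sigma^\chi)$ is an optimal symmetric profile in the LFC game for $D$. In particular, $\sigma^\chi$ is optimal in the LFC problem for $D$, and $$U(\sigma^\chi)=\max_{\sigma\in\Sigma^{\mathcal D}}U(\sigma)=\max_{\pi\in\Pi^D}J^D_{\mathrm{OP}}(\pi),$$ where both maxima are attained. -/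

import Mathlib

open MeasureTheory
open scoped BigOperators ENNReal

universe u v

/-- A finite-horizon Dec-POMDP. `Fin N` is the set of agents, joint actions and joint observations
are tuples indexed by the agents, `stdSimplex ℝ X` is the set of probability mass functions on the
finite set `X`, and `T` is the horizon (steps are `0, …, T`). -/
structure DecPOMDP : Type (u + 1) where
  N : ℕ
  State : Type u
  [stateFintype : Fintype State]
  Act : Fin N → Type u
  [actFintype : ∀ i, Fintype (Act i)]
  [actNonempty : ∀ i, Nonempty (Act i)]
  Obs : Fin N → Type u
  [obsFintype : ∀ i, Fintype (Obs i)]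
  /-- Transition kernel `P(· ∣ s, a)`. -/
  P : State → (∀ i, Act i) → stdSimplex ℝ State
  /-- Joint reward. -/
  R : State → (∀ i, Act i) → ℝ
  /-- Observation kernel `O(· ∣ s, a)`; `s` is the new state and `a` the preceding joint action. -/
  O : State → (∀ i, Act i) → stdSimplex ℝ (∀ i, Obs i)
  /-- Initial state distribution. -/
  b0 : stdSimplex ℝ State
  T : ℕ

attribute [instance] DecPOMDP.stateFintype DecPOMDP.actFintype DecPOMDP.actNonempty
  DecPOMDP.obsFintype

/-- Relabeling of a probability mass function along a bijection, `y ↦ p (e⁻¹ y)`. -/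
def simplexCongr {X : Type*} {Y : Type*} [Fintype X] [Fintype Y] (e : X ≃ Y)
    (p : stdSimplex ℝ X) : stdSimplex ℝ Y :=
  ⟨fun y => p (e.symm y), fun y => p.2.1 (e.symm y),
    (Equiv.sum_comp e.symm (fun x => p x)).trans p.2.2⟩

namespace DecPOMDP

/-! ### Policies -/

/-- Local stochastic policies of agent `i`: for every `t ∈ {0, …, T}` and every local
action-observation history `τ ∈ (Aᵢ × Oᵢ)ᵗ`, a distribution over actions `πᵢ(· ∣ τ)`. -/
abbrev LocalPolicy (D : DecPOMDP.{u}) (i : Fin D.N) : Type u :=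
  (t : Fin (D.T + 1)) → (Fin (t : ℕ) → D.Act i × D.Obs i) → stdSimplex ℝ (D.Act i)

/-- Joint policies. The (automatically inferred) `σ`-algebra is the product one, which is the Borel
`σ`-algebra of the policies as a subset of a finite-dimensional real vector space. -/
abbrev Policy (D : DecPOMDP.{u}) : Type u := (i : Fin D.N) → D.LocalPolicy i

/-! ### Histories, the process under a policy, and the expected return -/

/-- Histories of length `t`: states `s₀, …, sₜ`, joint actions `a₀, …, aₜ` and joint observations
`o₁, …, oₜ` (the entry of index `k` is `oₖ₊₁`). Rewards are functions of these. -/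
abbrev Hist (D : DecPOMDP.{u}) (t : ℕ) : Type u :=
  (Fin (t + 1) → D.State) × (Fin (t + 1) → ∀ i, D.Act i) × (Fin t → ∀ i, D.Obs i)

/-- The local action-observation history `(aᵢ₀, oᵢ₁, …, aᵢ₍ₖ₋₁₎, oᵢₖ)` of agent `i` at step `k`. -/
def aoHist {D : DecPOMDP.{u}} {t : ℕ} (h : D.Hist t) (i : Fin D.N) (k : ℕ) (hk : k ≤ t) :
    Fin k → D.Act i × D.Obs i :=
  fun l => (h.2.1 ⟨l, by omega⟩ i, h.2.2 ⟨l, by omega⟩ i)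

/-- `ℙ_π(Hₜ = h)`: `S₀ ∼ b₀`, `Sₖ₊₁ ∼ P(· ∣ Sₖ, Aₖ)`, `Oₖ₊₁ ∼ O(· ∣ Sₖ₊₁, Aₖ)`, and at every step
each agent samples its action independently from its local policy. -/
noncomputable def histProb {D : DecPOMDP.{u}} (π : D.Policy) (t : ℕ) (ht : t ≤ D.T)
    (h : D.Hist t) : ℝ :=
  D.b0 (h.1 0) *
    (∏ k : Fin t, D.P (h.1 k.castSucc) (h.2.1 k.castSucc) (h.1 k.succ) *
      D.O (h.1 k.succ) (h.2.1 k.castSucc) (h.2.2 k)) *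
    ∏ k : Fin (t + 1), ∏ i : Fin D.N,
      π i ⟨k, by omega⟩ (aoHist h i k (by omega)) (h.2.1 k i)

/-- The self-play objective `J(π) = 𝔼_π[∑ₜ Rₜ]`. -/
noncomputable def J (D : DecPOMDP.{u}) (π : D.Policy) : ℝ :=
  ∑ h : D.Hist D.T, histProb π D.T le_rfl h * ∑ t : Fin (D.T + 1), D.R (h.1 t) (h.2.1 t)

/-! ### Isomorphisms and pushforward policies -/

/-- Isomorphisms from `D` to `E`. The component maps are indexed by the agents `j` of the target:
`act j` is the map `f_{A_i} : A_i^D → A_j^E` with `i = f_N⁻¹ j`, and similarly for `obs j`. The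
induced map on joint actions is `f_A(a) = (f_{A_{f_N⁻¹ j}} a_{f_N⁻¹ j})_j`. -/
@[ext]
structure Iso (D : DecPOMDP.{u}) (E : DecPOMDP.{v}) where
  agent : Fin D.N ≃ Fin E.N
  state : D.State ≃ E.State
  act : ∀ j, D.Act (agent.symm j) ≃ E.Act j
  obs : ∀ j, D.Obs (agent.symm j) ≃ E.Obs j
  horizon_eq : D.T = E.T
  map_P : ∀ s s' a, D.P s a s' = E.P (state s) (agent.piCongr' act a) (state s')
  map_O : ∀ s a o, D.O s a o = E.O (state s) (agent.piCongr' act a) (agent.piCongr' obs o)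
  map_R : ∀ s a, D.R s a = E.R (state s) (agent.piCongr' act a)
  map_b0 : ∀ s, D.b0 s = E.b0 (state s)

/-- Automorphisms of `D`. -/
abbrev Aut (D : DecPOMDP.{u}) : Type u := Iso D D

instance (D : DecPOMDP.{u}) (E : DecPOMDP.{v}) : Finite (Iso D E) := by
  let F : Iso D E → (Σ e : Fin D.N ≃ Fin E.N, (D.State ≃ E.State) ×
      (∀ j, D.Act (e.symm j) ≃ E.Act j) × (∀ j, D.Obs (e.symm j) ≃ E.Obs j)) :=
    fun f => ⟨f.agent, f.state, f.act, f.obs⟩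
  refine Finite.of_injective F ?_
  rintro ⟨a, s, c, o, _, _, _, _, _⟩ ⟨a', s', c', o', _, _, _, _, _⟩ h
  simp only [F, Sigma.mk.injEq] at h
  obtain ⟨rfl, h⟩ := h
  simp only [heq_eq_eq, Prod.mk.injEq] at h
  obtain ⟨rfl, rfl, rfl⟩ := h
  rfl

noncomputable instance (D : DecPOMDP.{u}) (E : DecPOMDP.{v}) : Fintype (Iso D E) :=
  Fintype.ofFinite _

instance (D : DecPOMDP.{u}) : Nonempty D.Aut :=
  ⟨{ agent := Equiv.refl _, state := Equiv.refl _, act := fun _ => Equiv.refl _,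
     obs := fun _ => Equiv.refl _, horizon_eq := rfl, map_P := fun _ _ _ => rfl,
     map_O := fun _ _ _ => rfl, map_R := fun _ _ => rfl, map_b0 := fun _ => rfl }⟩

/-- Pushforward policy, `(f^*π)ⱼ(a ∣ τ) = π_{f⁻¹j}(f⁻¹a ∣ f⁻¹τ)`. -/
def push {D : DecPOMDP.{u}} {E : DecPOMDP.{v}} (f : Iso D E) (π : D.Policy) : E.Policy :=
  fun j t τ => simplexCongr (f.act j)
    (π (f.agent.symm j) (Fin.cast (congrArg (· + 1) f.horizon_eq.symm) t)
      (fun l => ((f.act j).symm (τ l).1, (f.obs j).symm (τ l).2)))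

theorem measurable_push {D : DecPOMDP.{u}} {E : DecPOMDP.{v}} (f : Iso D E) :
    Measurable (push f) := by
  refine measurable_pi_lambda _ fun j => measurable_pi_lambda _ fun t =>
    measurable_pi_lambda _ fun τ => Measurable.subtype_mk (measurable_pi_lambda _ fun a => ?_)
  exact (measurable_pi_apply _).comp (measurable_subtype_coe.comp ((measurable_pi_apply _).comp
    ((measurable_pi_apply _).comp (measurable_pi_apply _))))

/-- Pushforward `f^*ν = ν ∘ (f^*)⁻¹` of a distribution over joint policies. -/
noncomputable def pushDist {D : DecPOMDP.{u}} {E : DecPOMDP.{v}} (f : Iso D E)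
    (ν : ProbabilityMeasure D.Policy) : ProbabilityMeasure E.Policy :=
  ν.map (measurable_push f).aemeasurable

/-! ### Other-play -/

/-- For a profile `g` of automorphisms, the joint policy `g^*π` with `(g^*π)ᵢ = (gᵢ^*π)ᵢ`. -/
def profilePush {D : DecPOMDP.{u}} (g : Fin D.N → D.Aut) (π : D.Policy) : D.Policy :=
  fun i => push (g i) π i

/-- The other-play objective, the average of `J(g^*π)` over all profiles `g` of automorphisms. -/
noncomputable def JOP (D : DecPOMDP.{u}) (π : D.Policy) : ℝ :=
  Finset.expect Finset.univ fun g : Fin D.N → D.Aut => D.J (profilePush g π)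

/-- The set of OP-optimal policies. -/
def opOptimal (D : DecPOMDP.{u}) : Set D.Policy := {π | ∀ π', D.JOP π' ≤ D.JOP π}

/-- The OP distribution `|Aut(D)|^{-N} ∑_g δ_{g^*π}` of `π`. -/
noncomputable def opDist {D : DecPOMDP.{u}} (π : D.Policy) : ProbabilityMeasure D.Policy :=
  ⟨((Fintype.card (Fin D.N → D.Aut) : ℝ≥0∞)⁻¹) •
      ∑ g : Fin D.N → D.Aut, Measure.dirac (profilePush g π), ⟨by
    simp only [Measure.smul_apply, Measure.coe_finsetSum, Finset.sum_apply, measure_univ,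
      Finset.sum_const, Finset.card_univ, nsmul_eq_mul, mul_one, smul_eq_mul]
    exact ENNReal.inv_mul_cancel (Nat.cast_ne_zero.2 Fintype.card_ne_zero)
      (ENNReal.natCast_ne_top _)⟩⟩

/-! ### Policies corresponding to distributions over policies, and the symmetrizer -/

open scoped Classical in
/-- `ℙ_π(AO_{i,t} = τ)`. -/
noncomputable def aoProb {D : DecPOMDP.{u}} (π : D.Policy) (i : Fin D.N) (t : Fin (D.T + 1))
    (τ : Fin (t : ℕ) → D.Act i × D.Obs i) : ℝ :=
  ∑ h : D.Hist t, if aoHist h i t le_rfl = τ then histProb π t (by omega) h else 0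

open scoped Classical in
/-- `ℙ_π(AO_{i,t} = τ, A_{i,t} = a)`. -/
noncomputable def aoActProb {D : DecPOMDP.{u}} (π : D.Policy) (i : Fin D.N) (t : Fin (D.T + 1))
    (τ : Fin (t : ℕ) → D.Act i × D.Obs i) (a : D.Act i) : ℝ :=
  ∑ h : D.Hist t, if aoHist h i t le_rfl = τ ∧ h.2.1 (Fin.last t) i = a then
    histProb π t (by omega) h else 0

/-- `ℙ_μ(AO_{i,t} = τ)` for `μ = ⊗ⱼ μⱼ`: first a joint policy is drawn from `μ`, then it is
followed. -/
noncomputable def mixAOProb {D : DecPOMDP.{u}} (μ : ∀ j, ProbabilityMeasure (D.LocalPolicy j))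
    (i : Fin D.N) (t : Fin (D.T + 1)) (τ : Fin (t : ℕ) → D.Act i × D.Obs i) : ℝ :=
  ∫ π, aoProb π i t τ ∂(Measure.pi fun j => (μ j : Measure (D.LocalPolicy j)))

/-- `ℙ_μ(AO_{i,t} = τ, A_{i,t} = a)` for `μ = ⊗ⱼ μⱼ`. -/
noncomputable def mixAOActProb {D : DecPOMDP.{u}} (μ : ∀ j, ProbabilityMeasure (D.LocalPolicy j))
    (i : Fin D.N) (t : Fin (D.T + 1)) (τ : Fin (t : ℕ) → D.Act i × D.Obs i) (a : D.Act i) : ℝ :=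
  ∫ π, aoActProb π i t τ a ∂(Measure.pi fun j => (μ j : Measure (D.LocalPolicy j)))

theorem histProb_nonneg {D : DecPOMDP.{u}} (π : D.Policy) (t : ℕ) (ht : t ≤ D.T) (h : D.Hist t) :
    0 ≤ histProb π t ht h :=
  mul_nonneg (mul_nonneg (stdSimplex.zero_le _ _) (Finset.prod_nonneg fun _ _ =>
    mul_nonneg (stdSimplex.zero_le _ _) (stdSimplex.zero_le _ _)))
    (Finset.prod_nonneg fun _ _ => Finset.prod_nonneg fun _ _ => stdSimplex.zero_le _ _)

theorem histProb_le_one {D : DecPOMDP.{u}} (π : D.Policy) (t : ℕ) (ht : t ≤ D.T) (h : D.Hist t) :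
    histProb π t ht h ≤ 1 := by
  refine mul_le_one₀ (mul_le_one₀ (stdSimplex.le_one _ _) (Finset.prod_nonneg fun _ _ =>
    mul_nonneg (stdSimplex.zero_le _ _) (stdSimplex.zero_le _ _)) ?_)
    (Finset.prod_nonneg fun _ _ => Finset.prod_nonneg fun _ _ => stdSimplex.zero_le _ _) ?_
  · exact Finset.prod_le_one
      (fun _ _ => mul_nonneg (stdSimplex.zero_le _ _) (stdSimplex.zero_le _ _))
      (fun _ _ => mul_le_one₀ (stdSimplex.le_one _ _) (stdSimplex.zero_le _ _)
        (stdSimplex.le_one _ _))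
  · exact Finset.prod_le_one
      (fun _ _ => Finset.prod_nonneg fun _ _ => stdSimplex.zero_le _ _)
      (fun _ _ => Finset.prod_le_one (fun _ _ => stdSimplex.zero_le _ _)
        (fun _ _ => stdSimplex.le_one _ _))

theorem measurable_histProb {D : DecPOMDP.{u}} (t : ℕ) (ht : t ≤ D.T) (h : D.Hist t) :
    Measurable fun π : D.Policy => histProb π t ht h := by
  refine Measurable.const_mul (Finset.measurable_fun_prod _ fun k _ =>
    Finset.measurable_fun_prod _ fun i _ => ?_) _
  exact (measurable_pi_apply _).comp (measurable_subtype_coe.comp ((measurable_pi_apply _).comp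
    ((measurable_pi_apply _).comp (measurable_pi_apply _))))

theorem integrable_histProb {D : DecPOMDP.{u}} (m : Measure D.Policy) [IsFiniteMeasure m]
    (t : ℕ) (ht : t ≤ D.T) (h : D.Hist t) :
    Integrable (fun π : D.Policy => histProb π t ht h) m :=
  Integrable.of_bound (measurable_histProb t ht h).aestronglyMeasurable 1
    (Filter.Eventually.of_forall fun π => by
      rw [Real.norm_of_nonneg (histProb_nonneg π t ht h)]
      exact histProb_le_one π t ht h)

theorem integrable_aoActProb {D : DecPOMDP.{u}} (m : Measure D.Policy) [IsFiniteMeasure m]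
    (i : Fin D.N) (t : Fin (D.T + 1)) (τ : Fin (t : ℕ) → D.Act i × D.Obs i) (a : D.Act i) :
    Integrable (fun π : D.Policy => aoActProb π i t τ a) m := by
  unfold aoActProb
  refine integrable_finsetSum _ fun h _ => ?_
  split_ifs
  · exact integrable_histProb m _ _ h
  · exact integrable_zero _ _ _

theorem aoActProb_nonneg {D : DecPOMDP.{u}} (π : D.Policy) (i : Fin D.N) (t : Fin (D.T + 1))
    (τ : Fin (t : ℕ) → D.Act i × D.Obs i) (a : D.Act i) : 0 ≤ aoActProb π i t τ a := by
  unfold aoActProb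
  refine Finset.sum_nonneg fun h _ => ?_
  split_ifs
  · exact histProb_nonneg _ _ _ _
  · exact le_rfl

theorem sum_aoActProb {D : DecPOMDP.{u}} (π : D.Policy) (i : Fin D.N) (t : Fin (D.T + 1))
    (τ : Fin (t : ℕ) → D.Act i × D.Obs i) : ∑ a, aoActProb π i t τ a = aoProb π i t τ := by
  classical
  unfold aoActProb aoProb
  rw [Finset.sum_comm]
  refine Finset.sum_congr rfl fun h _ => ?_
  by_cases hτ : aoHist h i t le_rfl = τ <;> simp [hτ]

theorem sum_mixAOActProb {D : DecPOMDP.{u}} (μ : ∀ j, ProbabilityMeasure (D.LocalPolicy j))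
    (i : Fin D.N) (t : Fin (D.T + 1)) (τ : Fin (t : ℕ) → D.Act i × D.Obs i) :
    ∑ a, mixAOActProb μ i t τ a = mixAOProb μ i t τ := by
  unfold mixAOActProb mixAOProb
  rw [← integral_finsetSum _ fun a _ => integrable_aoActProb _ i t τ a]
  simp only [sum_aoActProb]

open scoped Classical in
/-- The local policy corresponding to a distribution `ν` over local policies of agent `i`:
`a ↦ ℙ_μ(A_{i,t} = a ∣ AO_{i,t} = τ)`, where `μ = ⊗ⱼ μⱼ` is any distribution with independent local
policies and `μᵢ = ν` for which the conditioning event has positive probability; it is the uniform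
distribution if there is no such `μ`. -/
noncomputable def localMixture {D : DecPOMDP.{u}} (i : Fin D.N)
    (ν : ProbabilityMeasure (D.LocalPolicy i)) : D.LocalPolicy i := fun t τ =>
  if hμ : ∃ μ : ∀ j, ProbabilityMeasure (D.LocalPolicy j), μ i = ν ∧ 0 < mixAOProb μ i t τ then
    ⟨fun a => mixAOActProb hμ.choose i t τ a / mixAOProb hμ.choose i t τ,
      fun a => div_nonneg (integral_nonneg fun π => aoActProb_nonneg π i t τ a)
        hμ.choose_spec.2.le,
      by rw [← Finset.sum_div, sum_mixAOActProb, div_self hμ.choose_spec.2.ne']⟩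
  else stdSimplex.barycenter

/-- The symmetrizer `Ψ`: the joint policy corresponding to the OP distribution of `π`. -/
noncomputable def symmetrizer {D : DecPOMDP.{u}} (π : D.Policy) : D.Policy :=
  fun i => localMixture i ((opDist π).map (measurable_pi_apply i).aemeasurable)

/-- The equivalence class `[π]` of `π`, where `π' ≡ π` means `Ψ(π') = Ψ(π)`. -/
def eqvClass {D : DecPOMDP.{u}} (π : D.Policy) : Set D.Policy :=
  {π' | symmetrizer π' = symmetrizer π}

/-! ### Labelings and relabeled Dec-POMDPs -/

/-- Labelings of `D` (the labels `{1, …, k}` are represented by `Fin k`). -/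
structure Labeling (D : DecPOMDP.{u}) where
  agent : Fin D.N ≃ Fin D.N
  state : D.State ≃ Fin (Fintype.card D.State)
  act : ∀ i, D.Act i ≃ Fin (Fintype.card (D.Act i))
  obs : ∀ i, D.Obs i ≃ Fin (Fintype.card (D.Obs i))

instance (D : DecPOMDP.{u}) : Finite D.Labeling := by
  refine Finite.of_injective (fun f : D.Labeling => (f.agent, f.state, f.act, f.obs)) ?_
  rintro ⟨a, s, c, o⟩ ⟨a', s', c', o'⟩ h
  simp only [Prod.mk.injEq] at h
  obtain ⟨rfl, rfl, rfl, rfl⟩ := h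
  rfl

namespace Labeling

/-- The action of a labeling on joint actions, `f a = (f_{A_{f⁻¹i}} a_{f⁻¹i})ᵢ`. -/
def jointAct {D : DecPOMDP.{u}} (f : D.Labeling) :
    (∀ i, D.Act i) ≃ ∀ i, Fin (Fintype.card (D.Act (f.agent.symm i))) :=
  f.agent.piCongr' fun i => f.act (f.agent.symm i)

/-- The action of a labeling on joint observations. -/
def jointObs {D : DecPOMDP.{u}} (f : D.Labeling) :
    (∀ i, D.Obs i) ≃ ∀ i, Fin (Fintype.card (D.Obs (f.agent.symm i))) :=
  f.agent.piCongr' fun i => f.obs (f.agent.symm i)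

end Labeling

/-- The relabeled Dec-POMDP `f^*D`. -/
def relabel (D : DecPOMDP.{u}) (f : D.Labeling) : DecPOMDP.{0} where
  N := D.N
  State := Fin (Fintype.card D.State)
  Act := fun i => Fin (Fintype.card (D.Act (f.agent.symm i)))
  actNonempty := fun i => Nonempty.map (f.act (f.agent.symm i)) inferInstance
  Obs := fun i => Fin (Fintype.card (D.Obs (f.agent.symm i)))
  P := fun s a => simplexCongr f.state (D.P (f.state.symm s) (f.jointAct.symm a))
  R := fun s a => D.R (f.state.symm s) (f.jointAct.symm a)
  O := fun s a => simplexCongr f.jointObs (D.O (f.state.symm s) (f.jointAct.symm a))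
  b0 := simplexCongr f.state D.b0
  T := D.T

/-- The set of all relabeled versions of `D`. -/
def relabelings (D : DecPOMDP.{u}) : Set DecPOMDP.{0} := Set.range D.relabel

noncomputable instance (D : DecPOMDP.{u}) : Fintype D.relabelings :=
  (Set.finite_range D.relabel).fintype

/-! ### Learning algorithms and the label-free coordination game -/

/-- Learning algorithms for a set `C` of Dec-POMDPs. -/
abbrev LearningAlg (C : Set DecPOMDP.{u}) : Type (u + 1) :=
  (E : C) → ProbabilityMeasure E.1.Policy

/-- The common payoff `U^D(σ₁, …, σ_N)` of the LFC game for `D`: each principal `k` independently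
gets a uniformly random relabeled problem `Dₖ` and a uniformly random isomorphism `fₖ` from `Dₖ` to
`D`; joint policies `π⁽ᵏ⁾ ∼ fₖ^* σₖ(Dₖ)` are drawn independently, and `(π⁽ˡ⁾ₗ)ₗ` is evaluated
in `D`. -/
noncomputable def payoff (D : DecPOMDP.{u}) (σ : Fin D.N → LearningAlg D.relabelings) : ℝ :=
  Finset.expect Finset.univ fun Ds : Fin D.N → D.relabelings =>
    Finset.expect Finset.univ fun f : ((j : Fin D.N) → Iso (Ds j).1 D) =>
      ∫ π : Fin D.N → D.Policy, D.J (fun l => π l l)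
        ∂(Measure.pi fun k => (pushDist (f k) (σ k (Ds k)) : Measure D.Policy))

/-- The value of a learning algorithm in the LFC problem for `D`: all principals use it. -/
noncomputable def lfcValue (D : DecPOMDP.{u}) (σ : LearningAlg D.relabelings) : ℝ :=
  D.payoff fun _ => σ

/-- A learning algorithm is optimal in the LFC problem for `D`. -/
def IsLFCOptimal (D : DecPOMDP.{u}) (σ : LearningAlg D.relabelings) : Prop :=
  ∀ σ' : LearningAlg D.relabelings, D.lfcValue σ' ≤ D.lfcValue σ

/-- Symmetric strategy profiles: `σᵢ = σ_{g⁻¹i}` for all automorphisms `g` and principals `i`. -/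
def IsSymmetricProfile (D : DecPOMDP.{u}) (σ : Fin D.N → LearningAlg D.relabelings) : Prop :=
  ∀ (g : D.Aut) (i : Fin D.N), σ i = σ (g.agent.symm i)

/-- Optimal symmetric strategy profiles of the LFC game for `D`. -/
def IsOptimalSymmetricProfile (D : DecPOMDP.{u}) (σ : Fin D.N → LearningAlg D.relabelings) :
    Prop :=
  D.IsSymmetricProfile σ ∧ ∀ σ', D.IsSymmetricProfile σ' → D.payoff σ' ≤ D.payoff σ

/-! ### Other-play with tie-breaking -/

/-- `χ` is a tie-breaking function for `C`: it attains a maximum on the OP-optimal policies of every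
`E ∈ C`, and policies of `E` with equal values are equivalent. -/
def IsTieBreaking (C : Set DecPOMDP.{u}) (χ : (E : C) → E.1.Policy → Set.Icc (0 : ℝ) 1) : Prop :=
  (∀ E : C, ∃ π ∈ E.1.opOptimal, IsMaxOn (χ E) E.1.opOptimal π) ∧
  ∀ (E : C) (π π' : E.1.Policy), χ E π = χ E π' → symmetrizer π = symmetrizer π'

/-- `χ` is invariant to isomorphism: `f^*[π] = [π']` implies `χ(E, π) = χ(F, π')`, where
`f^*[π] = [f^*π]`. -/
def IsIsoInvariant (C : Set DecPOMDP.{u}) (χ : (E : C) → E.1.Policy → Set.Icc (0 : ℝ) 1) : Prop :=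
  ∀ (E F : C) (f : Iso E.1 F.1) (π : E.1.Policy) (π' : F.1.Policy),
    eqvClass (push f π) = eqvClass π' → χ E π = χ F π'

/-- `σ` is an OP with tie-breaking learning algorithm for `C` and `χ`: on every `E ∈ C` it is
concentrated on a measurable set of OP-optimal policies that maximize `χ` among these. -/
def IsOPWithTieBreaking (C : Set DecPOMDP.{u}) (χ : (E : C) → E.1.Policy → Set.Icc (0 : ℝ) 1)
    (σ : LearningAlg C) : Prop :=
  ∀ E : C, ∃ Z : Set E.1.Policy, MeasurableSet Z ∧ Z ⊆ E.1.opOptimal ∧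
    (σ E : Measure E.1.Policy) Z = 1 ∧ ∀ π ∈ Z, IsMaxOn (χ E) E.1.opOptimal π

end DecPOMDP

/-!
The payoff of a profile is the expected return when every agent draws its local policy
independently from the distribution its principal induces on the policies of `D`. A principal's
random relabeling makes this distribution invariant under `Aut D`.

Conditioning on a local history of agent `i` cancels the contributions of the environment and of
the other agents, since those do not depend on the next action of agent `i`. Hence `localMixture`
plays every reachable history with the mean weight under the mixture, and, as in Kuhn's theorem, an
independent mixture of local policies has the same expected return as the joint policy of these
behavioral policies. For a symmetric profile, the behavioral policies obtained from the induced
distributions form a joint policy `q` all of whose pushforwards by tuples of automorphisms realize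
the same mixture, so the payoff is the other-play value of `q`, at most `max J_OP`.

By invariance, the payoff of any profile is also a mean of other-play values in which each agent
uses a policy of its own (`crossOP`), and by Kuhn's theorem such a value depends only on the
symmetrizers of the policies. An isomorphism carries `χ`-maximal OP-optimal policies to `χ`-maximal
OP-optimal policies, and these have a common symmetrizer. So under OP with tie-breaking all the
averaged values equal `max J_OP`.
-/

/-! ### Uniform mixtures -/

/-- The mixture of a nonempty finite family of probability measures with equal weights. -/
noncomputable def uniformMixture {X κ : Type*} [MeasurableSpace X] [Fintype κ] [Nonempty κ]
    (ν : κ → ProbabilityMeasure X) : ProbabilityMeasure X :=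
  ⟨((Fintype.card κ : ℝ≥0∞)⁻¹) • ∑ k, (ν k : Measure X), ⟨by
    simp only [Measure.smul_apply, Measure.coe_finsetSum, Finset.sum_apply, measure_univ,
      Finset.sum_const, Finset.card_univ, nsmul_eq_mul, mul_one, smul_eq_mul]
    exact ENNReal.inv_mul_cancel (Nat.cast_ne_zero.2 Fintype.card_ne_zero)
      (ENNReal.natCast_ne_top _)⟩⟩

section UniformMixture

variable {X Y κ : Type*} [MeasurableSpace X] [MeasurableSpace Y] [Fintype κ]

theorem integrable_expect {μ : Measure X} {F : κ → X → ℝ} (hF : ∀ k, Integrable (F k) μ) :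
    Integrable (fun x => Finset.expect Finset.univ fun k => F k x) μ := by
  simp only [Fintype.expect_eq_sum_div_card]
  exact (integrable_finsetSum _ fun k _ => hF k).div_const _

theorem integral_expect {μ : Measure X} {F : κ → X → ℝ} (hF : ∀ k, Integrable (F k) μ) :
    ∫ x, Finset.expect Finset.univ (fun k => F k x) ∂μ =
      Finset.expect Finset.univ fun k => ∫ x, F k x ∂μ := by
  simp only [Fintype.expect_eq_sum_div_card]
  rw [integral_div, integral_finsetSum _ fun k _ => hF k]

variable [Nonempty κ]

theorem toMeasure_uniformMixture (ν : κ → ProbabilityMeasure X) :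
    (uniformMixture ν : Measure X) = ((Fintype.card κ : ℝ≥0∞)⁻¹) • ∑ k, (ν k : Measure X) :=
  rfl

theorem toMeasure_uniformMixture_apply (ν : κ → ProbabilityMeasure X) (s : Set X) :
    (uniformMixture ν : Measure X) s = (Fintype.card κ : ℝ≥0∞)⁻¹ * ∑ k, (ν k : Measure X) s := by
  rw [toMeasure_uniformMixture, Measure.smul_apply, Measure.coe_finsetSum, Finset.sum_apply,
    smul_eq_mul]

theorem integral_uniformMixture (ν : κ → ProbabilityMeasure X) {F : X → ℝ}
    (hF : ∀ k, Integrable F (ν k : Measure X)) :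
    ∫ x, F x ∂(uniformMixture ν : Measure X) =
      Finset.expect Finset.univ fun k => ∫ x, F x ∂(ν k : Measure X) := by
  rw [toMeasure_uniformMixture, integral_smul_measure,
    integral_finsetSum_measure fun k _ => hF k, Fintype.expect_eq_sum_div_card,
    ENNReal.toReal_inv, ENNReal.toReal_natCast, smul_eq_mul, inv_mul_eq_div]

theorem uniformMixture_map (ν : κ → ProbabilityMeasure X) {f : X → Y} (hf : Measurable f) :
    (uniformMixture ν).map hf.aemeasurable =
      uniformMixture fun k => (ν k).map hf.aemeasurable := by
  refine ProbabilityMeasure.toMeasure_injective (Measure.ext fun s hs => ?_)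
  simp only [ProbabilityMeasure.toMeasure_map, toMeasure_uniformMixture_apply,
    Measure.map_apply hf hs]

theorem uniformMixture_comp {ι : Type*} [Fintype ι] [Nonempty ι] (ν : κ → ProbabilityMeasure X)
    {e : ι → κ} (he : Function.Bijective e) :
    uniformMixture (fun i => ν (e i)) = uniformMixture ν := by
  refine ProbabilityMeasure.toMeasure_injective ?_
  rw [toMeasure_uniformMixture, toMeasure_uniformMixture, Fintype.card_of_bijective he,
    he.sum_comp fun k => (ν k : Measure X)]

end UniformMixture

section ProductMeasures

variable {ι : Type*} [Fintype ι] {X : ι → Type*} [∀ i, MeasurableSpace (X i)]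

theorem pi_uniformMixture [DecidableEq ι] {κ : ι → Type*} [∀ i, Fintype (κ i)]
    [∀ i, Nonempty (κ i)] (ν : ∀ i, κ i → ProbabilityMeasure (X i)) :
    ProbabilityMeasure.pi (fun i => uniformMixture (ν i)) =
      uniformMixture fun k : ∀ i, κ i => ProbabilityMeasure.pi fun i => ν i (k i) := by
  refine ProbabilityMeasure.toMeasure_injective (Measure.pi_eq fun s _ => ?_)
  simp only [toMeasure_uniformMixture_apply, ProbabilityMeasure.toMeasure_pi, Measure.pi_pi,
    Finset.prod_mul_distrib, Finset.prod_univ_sum, Fintype.piFinset_univ, Fintype.card_pi,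
    Nat.cast_prod]
  rw [ENNReal.prod_inv_distrib fun _ _ _ _ _ => Or.inr (ENNReal.natCast_ne_top _)]

theorem pi_diracProba (x : ∀ i, X i) :
    ProbabilityMeasure.pi (fun i => diracProba (x i)) = diracProba x := by
  refine ProbabilityMeasure.toMeasure_injective (Measure.pi_eq fun s hs => ?_)
  have h := Set.indicator_pi_one_apply (M₀ := ℝ≥0∞) Finset.univ s x
  simpa [diracProba, Measure.dirac_apply' _ (hs _),
    Measure.dirac_apply' _ (MeasurableSet.univ_pi hs)] using h

theorem pi_uniformMixture_diracProba [DecidableEq ι] {κ : ι → Type*} [∀ i, Fintype (κ i)]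
    [∀ i, Nonempty (κ i)] (x : ∀ i, κ i → X i) :
    ProbabilityMeasure.pi (fun i => uniformMixture fun k => diracProba (x i k)) =
      uniformMixture fun k : ∀ i, κ i => diracProba fun i => x i (k i) := by
  simp only [pi_uniformMixture, pi_diracProba]

theorem integral_pi_map {Y : ι → Type*} [∀ i, MeasurableSpace (Y i)]
    (ν : ∀ i, ProbabilityMeasure (X i)) {f : ∀ i, X i → Y i} (hf : ∀ i, Measurable (f i))
    {F : (∀ i, Y i) → ℝ} (hF : AEStronglyMeasurable F
      (Measure.pi fun i => ((ν i).map (hf i).aemeasurable : Measure (Y i)))) :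
    ∫ y, F y ∂(Measure.pi fun i => ((ν i).map (hf i).aemeasurable : Measure (Y i))) =
      ∫ x, F (fun i => f i (x i)) ∂(Measure.pi fun i => (ν i : Measure (X i))) := by
  have : ∀ i, SigmaFinite ((ν i : Measure (X i)).map (f i)) := fun i =>
    inferInstanceAs (SigmaFinite ((ν i).map (hf i).aemeasurable : Measure (Y i)))
  have hmap := Measure.pi_map_pi (μ := fun i => (ν i : Measure (X i))) fun i =>
    (hf i).aemeasurable
  simp only [ProbabilityMeasure.toMeasure_map] at hF ⊢
  rw [← hmap] at hF ⊢
  exact integral_map (measurable_pi_lambda _ fun i =>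
    (hf i).comp (measurable_pi_apply i)).aemeasurable hF

end ProductMeasures

namespace DecPOMDP

/-! ### Realization weights -/

section RealizationWeights

variable {D : DecPOMDP.{u}} {i : Fin D.N}

/-- Local action-observation histories of length `t` of agent `i`. -/
abbrev LocalHist (D : DecPOMDP.{u}) (i : Fin D.N) (t : ℕ) : Type u := Fin t → D.Act i × D.Obs i

/-- The factor of the probability of a history that does not depend on the policy. -/
noncomputable def envWeight {t : ℕ} (h : D.Hist t) : ℝ :=
  D.b0 (h.1 0) *
    ∏ k : Fin t, D.P (h.1 k.castSucc) (h.2.1 k.castSucc) (h.1 k.succ) *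
      D.O (h.1 k.succ) (h.2.1 k.castSucc) (h.2.2 k)

/-- The realization weight of a local history `τ` under `p`, i.e. the probability that `p` plays
the actions of `τ` provided that the observations of `τ` are made. -/
noncomputable def playProb (p : D.LocalPolicy i) (t : Fin (D.T + 1)) (τ : D.LocalHist i t) : ℝ :=
  ∏ k : Fin (t : ℕ), p ⟨k, k.2.trans t.2⟩ (fun l => τ (Fin.castLT l (l.2.trans k.2))) (τ k).1

/-- The realization weight of `τ` followed by the action `a`. -/
noncomputable def playActProb (p : D.LocalPolicy i) (t : Fin (D.T + 1)) (τ : D.LocalHist i t)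
    (a : D.Act i) : ℝ :=
  playProb p t τ * p t τ a

/-- The mean of `playProb` when the local policy is drawn from `ν`. -/
noncomputable def meanPlayProb (ν : ProbabilityMeasure (D.LocalPolicy i)) (t : Fin (D.T + 1))
    (τ : D.LocalHist i t) : ℝ :=
  ∫ p, playProb p t τ ∂(ν : Measure (D.LocalPolicy i))

/-- The mean of `playActProb` when the local policy is drawn from `ν`. -/
noncomputable def meanPlayActProb (ν : ProbabilityMeasure (D.LocalPolicy i)) (t : Fin (D.T + 1))
    (τ : D.LocalHist i t) (a : D.Act i) : ℝ :=
  ∫ p, playActProb p t τ a ∂(ν : Measure (D.LocalPolicy i))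

theorem envWeight_nonneg {t : ℕ} (h : D.Hist t) : 0 ≤ envWeight h :=
  mul_nonneg (stdSimplex.zero_le _ _) (Finset.prod_nonneg fun _ _ =>
    mul_nonneg (stdSimplex.zero_le _ _) (stdSimplex.zero_le _ _))

theorem playProb_zero (p : D.LocalPolicy i) (τ : D.LocalHist i 0) : playProb p 0 τ = 1 :=
  Fin.prod_univ_zero _

theorem playProb_succ (p : D.LocalPolicy i) (t : Fin D.T) (τ : D.LocalHist i (t + 1)) :
    playProb p t.succ τ =
      playActProb p t.castSucc (fun l => τ l.castSucc) (τ (Fin.last t)).1 :=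
  Fin.prod_univ_castSucc _

theorem playProb_nonneg (p : D.LocalPolicy i) (t : Fin (D.T + 1)) (τ : D.LocalHist i t) :
    0 ≤ playProb p t τ :=
  Finset.prod_nonneg fun _ _ => stdSimplex.zero_le _ _

theorem playActProb_nonneg (p : D.LocalPolicy i) (t : Fin (D.T + 1)) (τ : D.LocalHist i t)
    (a : D.Act i) : 0 ≤ playActProb p t τ a :=
  mul_nonneg (playProb_nonneg _ _ _) (stdSimplex.zero_le _ _)

theorem playActProb_le_one (p : D.LocalPolicy i) (t : Fin (D.T + 1)) (τ : D.LocalHist i t)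
    (a : D.Act i) : playActProb p t τ a ≤ 1 :=
  mul_le_one₀ (Finset.prod_le_one (fun _ _ => stdSimplex.zero_le _ _) fun _ _ =>
    stdSimplex.le_one _ _) (stdSimplex.zero_le _ _) (stdSimplex.le_one _ _)

theorem sum_playActProb (p : D.LocalPolicy i) (t : Fin (D.T + 1)) (τ : D.LocalHist i t) :
    ∑ a, playActProb p t τ a = playProb p t τ := by
  simp only [playActProb, ← Finset.mul_sum]
  exact (congrArg _ (p t τ).2.2).trans (mul_one _)

theorem measurable_playActProb (t : Fin (D.T + 1)) (τ : D.LocalHist i t) (a : D.Act i) :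
    Measurable fun p : D.LocalPolicy i => playActProb p t τ a := by
  have hm : ∀ (k : Fin (D.T + 1)) (τ' : D.LocalHist i k) (b : D.Act i),
      Measurable fun p : D.LocalPolicy i => p k τ' b := fun k τ' b =>
    (measurable_pi_apply b).comp (measurable_subtype_coe.comp
      ((measurable_pi_apply τ').comp (measurable_pi_apply k)))
  exact (Finset.measurable_fun_prod _ fun _ _ => hm _ _ _).mul (hm _ _ _)

theorem integrable_playActProb (m : Measure (D.LocalPolicy i)) [IsFiniteMeasure m]
    (t : Fin (D.T + 1)) (τ : D.LocalHist i t) (a : D.Act i) :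
    Integrable (fun p : D.LocalPolicy i => playActProb p t τ a) m :=
  Integrable.of_bound (measurable_playActProb t τ a).aestronglyMeasurable 1
    (Filter.Eventually.of_forall fun p => by
      rw [Real.norm_of_nonneg (playActProb_nonneg p t τ a)]
      exact playActProb_le_one p t τ a)

theorem meanPlayProb_nonneg (ν : ProbabilityMeasure (D.LocalPolicy i)) (t : Fin (D.T + 1))
    (τ : D.LocalHist i t) : 0 ≤ meanPlayProb ν t τ :=
  integral_nonneg fun p => playProb_nonneg p t τ

theorem meanPlayActProb_nonneg (ν : ProbabilityMeasure (D.LocalPolicy i)) (t : Fin (D.T + 1))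
    (τ : D.LocalHist i t) (a : D.Act i) : 0 ≤ meanPlayActProb ν t τ a :=
  integral_nonneg fun p => playActProb_nonneg p t τ a

theorem sum_meanPlayActProb (ν : ProbabilityMeasure (D.LocalPolicy i)) (t : Fin (D.T + 1))
    (τ : D.LocalHist i t) : ∑ a, meanPlayActProb ν t τ a = meanPlayProb ν t τ := by
  unfold meanPlayActProb meanPlayProb
  rw [← integral_finsetSum _ fun a _ => integrable_playActProb _ t τ a]
  simp only [sum_playActProb]

theorem meanPlayActProb_eq_zero {ν : ProbabilityMeasure (D.LocalPolicy i)} {t : Fin (D.T + 1)}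
    {τ : D.LocalHist i t} (h : meanPlayProb ν t τ = 0) (a : D.Act i) :
    meanPlayActProb ν t τ a = 0 :=
  (Finset.sum_eq_zero_iff_of_nonneg fun b _ => meanPlayActProb_nonneg ν t τ b).1
    ((sum_meanPlayActProb ν t τ).trans h) a (Finset.mem_univ a)

theorem histProb_eq_envWeight_mul (π : D.Policy) (t : Fin (D.T + 1)) (h : D.Hist t) :
    histProb π t (Nat.le_of_lt_succ t.2) h = envWeight h *
      ∏ i, playActProb (π i) t (aoHist h i t le_rfl) (h.2.1 (Fin.last t) i) := by
  rw [histProb, Finset.prod_comm]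
  exact congrArg _ (Finset.prod_congr rfl fun i _ => Fin.prod_univ_castSucc _)

theorem integral_histProb (μ : ∀ j, ProbabilityMeasure (D.LocalPolicy j)) (t : Fin (D.T + 1))
    (h : D.Hist t) :
    ∫ π, histProb π t (Nat.le_of_lt_succ t.2) h
        ∂(Measure.pi fun j => (μ j : Measure (D.LocalPolicy j))) =
      envWeight h * ∏ j, meanPlayActProb (μ j) t (aoHist h j t le_rfl)
        (h.2.1 (Fin.last t) j) := by
  simp only [histProb_eq_envWeight_mul, integral_const_mul]
  exact congrArg _ (integral_fintype_prod_eq_prod fun j (p : D.LocalPolicy j) =>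
    playActProb p t (aoHist h j t le_rfl) (h.2.1 (Fin.last t) j))

end RealizationWeights

/-! ### Independent mixtures of local policies and Kuhn's theorem -/

section Kuhn

variable {D : DecPOMDP.{u}} {i : Fin D.N}

/-- A local history is reachable if the environment can produce its observations in response to
its actions and some actions of the other agents. -/
def IsReachable {t : ℕ} (τ : D.LocalHist i t) : Prop :=
  ∃ h : D.Hist t, envWeight h ≠ 0 ∧ aoHist h i t le_rfl = τ

theorem IsReachable.init {t : ℕ} {τ : D.LocalHist i (t + 1)} (hτ : IsReachable τ) :
    IsReachable fun l => τ l.castSucc := by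
  obtain ⟨h, h0, rfl⟩ := hτ
  obtain ⟨hb, hp⟩ := mul_ne_zero_iff.1 h0
  refine ⟨(Fin.init h.1, Fin.init h.2.1, Fin.init h.2.2), mul_ne_zero hb ?_, rfl⟩
  exact left_ne_zero_of_mul ((Fin.prod_univ_castSucc _).symm.trans_ne hp)

open scoped Classical in
/-- The counterfactual reach weight of `τ` followed by `a`: the realization weight of the
environment and of the agents `j ≠ i`, whose local policies are drawn independently from `μ j`. -/
noncomputable def counterfactualReach (μ : ∀ j, ProbabilityMeasure (D.LocalPolicy j))
    (i : Fin D.N) (t : Fin (D.T + 1)) (τ : D.LocalHist i t) (a : D.Act i) : ℝ :=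
  ∑ h : D.Hist t, if aoHist h i t le_rfl = τ ∧ h.2.1 (Fin.last t) i = a then
    envWeight h * ∏ j ∈ Finset.univ.erase i,
      meanPlayActProb (μ j) t (aoHist h j t le_rfl) (h.2.1 (Fin.last t) j) else 0

theorem mixAOActProb_eq_mul_counterfactualReach
    (μ : ∀ j, ProbabilityMeasure (D.LocalPolicy j)) (i : Fin D.N) (t : Fin (D.T + 1))
    (τ : D.LocalHist i t) (a : D.Act i) :
    mixAOActProb μ i t τ a = meanPlayActProb (μ i) t τ a * counterfactualReach μ i t τ a := by
  unfold mixAOActProb aoActProb counterfactualReach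
  rw [integral_finsetSum, Finset.mul_sum]
  · refine Finset.sum_congr rfl fun h _ => ?_
    split_ifs with hh
    · rw [integral_histProb, ← Finset.mul_prod_erase _ _ (Finset.mem_univ i), hh.1, hh.2,
        mul_left_comm]
    · rw [integral_zero, mul_zero]
  · intro h _
    split_ifs
    · exact integrable_histProb _ _ _ h
    · exact integrable_zero _ _ _

/-- The permutation of the histories that applies `e` to the last action of agent `i`. -/
def permLastAct (t : ℕ) (i : Fin D.N) (e : Equiv.Perm (D.Act i)) : Equiv.Perm (D.Hist t) :=
  (Equiv.refl _).prodCongr ((Equiv.piCongrRight (Function.update (fun _ => Equiv.refl _)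
    (Fin.last t) (Equiv.piCongrRight (Function.update (fun _ => Equiv.refl _) i e)))).prodCongr
      (Equiv.refl _))

theorem permLastAct_castSucc {t : ℕ} (e : Equiv.Perm (D.Act i)) (h : D.Hist t) (k : Fin t) :
    (permLastAct t i e h).2.1 k.castSucc = h.2.1 k.castSucc := by
  simp [permLastAct]

theorem permLastAct_last {t : ℕ} (e : Equiv.Perm (D.Act i)) (h : D.Hist t) (j : Fin D.N) :
    (permLastAct t i e h).2.1 (Fin.last t) j =
      Function.update (fun j => Equiv.refl (D.Act j)) i e j (h.2.1 (Fin.last t) j) := by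
  simp [permLastAct]

theorem envWeight_permLastAct {t : ℕ} (e : Equiv.Perm (D.Act i)) (h : D.Hist t) :
    envWeight (permLastAct t i e h) = envWeight h := by
  simp only [envWeight, permLastAct_castSucc]
  rfl

theorem aoHist_permLastAct {t : ℕ} (e : Equiv.Perm (D.Act i)) (h : D.Hist t) (j : Fin D.N) :
    aoHist (permLastAct t i e h) j t le_rfl = aoHist h j t le_rfl :=
  funext fun l => Prod.ext (congrFun (permLastAct_castSucc e h l) j) rfl

theorem counterfactualReach_congr (μ : ∀ j, ProbabilityMeasure (D.LocalPolicy j)) (i : Fin D.N)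
    (t : Fin (D.T + 1)) (τ : D.LocalHist i t) (a b : D.Act i) :
    counterfactualReach μ i t τ a = counterfactualReach μ i t τ b := by
  classical
  refine Fintype.sum_equiv (permLastAct t i (Equiv.swap a b)) _ _ fun h => ?_
  have hlast : (permLastAct t i (Equiv.swap a b) h).2.1 (Fin.last t) i = b ↔
      h.2.1 (Fin.last t) i = a := by
    rw [permLastAct_last, Function.update_self, Equiv.swap_apply_eq_iff, Equiv.swap_apply_right]
  simp only [hlast, envWeight_permLastAct, aoHist_permLastAct]
  refine if_congr Iff.rfl (congrArg _ (Finset.prod_congr rfl fun j hj => ?_)) rfl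
  rw [permLastAct_last, Function.update_of_ne (Finset.ne_of_mem_erase hj)]
  rfl

theorem mixAOProb_eq_mul_counterfactualReach (μ : ∀ j, ProbabilityMeasure (D.LocalPolicy j))
    (i : Fin D.N) (t : Fin (D.T + 1)) (τ : D.LocalHist i t) (a : D.Act i) :
    mixAOProb μ i t τ = meanPlayProb (μ i) t τ * counterfactualReach μ i t τ a := by
  rw [← sum_mixAOActProb, ← sum_meanPlayActProb, Finset.sum_mul]
  exact Finset.sum_congr rfl fun b _ => by
    rw [mixAOActProb_eq_mul_counterfactualReach, counterfactualReach_congr μ i t τ b a]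

/-- The local policy that always plays uniformly at random. -/
noncomputable def uniformPolicy (i : Fin D.N) : D.LocalPolicy i :=
  fun _ _ => stdSimplex.barycenter

theorem playActProb_uniformPolicy_pos (t : Fin (D.T + 1)) (τ : D.LocalHist i t) (a : D.Act i) :
    0 < playActProb (uniformPolicy i) t τ a := by
  have hpos (b : D.Act i) : 0 < (stdSimplex.barycenter : stdSimplex ℝ (D.Act i)) b :=
    (inv_pos.2 (Nat.cast_pos.2 Fintype.card_pos)).trans_eq (stdSimplex.barycenter_apply b).symm
  exact mul_pos (Finset.prod_pos fun _ _ => hpos _) (hpos _)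

theorem IsReachable.exists_mixAOProb_pos {t : Fin (D.T + 1)} {τ : D.LocalHist i t}
    (hτ : IsReachable τ) {ν : ProbabilityMeasure (D.LocalPolicy i)} (hν : meanPlayProb ν t τ ≠ 0) :
    ∃ μ : ∀ j, ProbabilityMeasure (D.LocalPolicy j), μ i = ν ∧ 0 < mixAOProb μ i t τ := by
  obtain ⟨h, h0, rfl⟩ := hτ
  refine ⟨Function.update (fun j => diracProba (uniformPolicy j)) i ν, Function.update_self ..,
    ?_⟩
  rw [mixAOProb_eq_mul_counterfactualReach _ _ _ _ (h.2.1 (Fin.last t) i), Function.update_self]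
  refine mul_pos ((meanPlayProb_nonneg _ _ _).lt_of_ne' hν)
    (Finset.sum_pos' (fun h' _ => ?_) ⟨h, Finset.mem_univ h, ?_⟩)
  · split_ifs
    · exact mul_nonneg (envWeight_nonneg _)
        (Finset.prod_nonneg fun _ _ => meanPlayActProb_nonneg _ _ _ _)
    · exact le_rfl
  · rw [if_pos ⟨rfl, rfl⟩]
    refine mul_pos ((envWeight_nonneg h).lt_of_ne' h0) (Finset.prod_pos fun j hj => ?_)
    rw [Function.update_of_ne (Finset.ne_of_mem_erase hj), meanPlayActProb]
    exact (playActProb_uniformPolicy_pos _ _ _).trans_eq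
      (integral_dirac' _ _ (measurable_playActProb _ _ _).stronglyMeasurable).symm

theorem meanPlayProb_mul_localMixture (ν : ProbabilityMeasure (D.LocalPolicy i))
    {t : Fin (D.T + 1)} {τ : D.LocalHist i t} (hτ : IsReachable τ) (a : D.Act i) :
    meanPlayProb ν t τ * localMixture i ν t τ a = meanPlayActProb ν t τ a := by
  by_cases hν : meanPlayProb ν t τ = 0
  · rw [hν, zero_mul, meanPlayActProb_eq_zero hν]
  have hex := hτ.exists_mixAOProb_pos hν
  have hpos := hex.choose_spec.2
  rw [localMixture, dif_pos hex]
  change _ * (mixAOActProb hex.choose i t τ a / mixAOProb hex.choose i t τ) = _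
  rw [mixAOProb_eq_mul_counterfactualReach _ i t τ a] at hpos ⊢
  rw [mixAOActProb_eq_mul_counterfactualReach,
    mul_div_mul_right _ _ (right_ne_zero_of_mul hpos.ne'), hex.choose_spec.1,
    mul_div_cancel₀ _ hν]

/-- The local policy `q` realizes the mixture `ν` of local policies: both give the same weight to
every reachable local history followed by an action. -/
def Realizes (q : D.LocalPolicy i) (ν : ProbabilityMeasure (D.LocalPolicy i)) : Prop :=
  ∀ (t : Fin (D.T + 1)) (τ : D.LocalHist i t), IsReachable τ →
    ∀ a, playActProb q t τ a = meanPlayActProb ν t τ a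

theorem realizes_localMixture (ν : ProbabilityMeasure (D.LocalPolicy i)) :
    Realizes (localMixture i ν) ν := by
  have hplay (t : Fin (D.T + 1)) : ∀ τ : D.LocalHist i t, IsReachable τ →
      playProb (localMixture i ν) t τ = meanPlayProb ν t τ := by
    induction t using Fin.induction with
    | zero =>
      intro τ _
      have hone (p : D.LocalPolicy i) : playProb p 0 τ = 1 := playProb_zero p τ
      simp only [meanPlayProb, hone, integral_const, probReal_univ, one_smul]
    | succ t ih =>
      intro τ hτ
      simp only [meanPlayProb, playProb_succ]
      exact (congrArg (· * _) (ih _ hτ.init)).trans (meanPlayProb_mul_localMixture ν hτ.init _)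
  intro t τ hτ a
  rw [playActProb, hplay t τ hτ, meanPlayProb_mul_localMixture ν hτ]

theorem measurable_J (D : DecPOMDP.{u}) : Measurable D.J :=
  Finset.measurable_fun_sum _ fun h _ => (measurable_histProb _ _ h).mul_const _

theorem integrable_J (m : Measure D.Policy) [IsFiniteMeasure m] : Integrable D.J m :=
  integrable_finsetSum _ fun h _ => (integrable_histProb m _ _ h).mul_const _

theorem J_eq_integral_pi_of_realizes {q : D.Policy}
    {ν : ∀ i, ProbabilityMeasure (D.LocalPolicy i)} (hq : ∀ i, Realizes (q i) (ν i)) :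
    D.J q = ∫ π, D.J π ∂(Measure.pi fun i => (ν i : Measure (D.LocalPolicy i))) := by
  unfold J
  rw [integral_finsetSum _ fun h _ => (integrable_histProb _ _ _ h).mul_const _]
  refine Finset.sum_congr rfl fun h _ => ?_
  rw [integral_mul_const]
  refine congrArg (· * _) ((histProb_eq_envWeight_mul q (Fin.last D.T) h).trans
    (Eq.trans ?_ (integral_histProb ν (Fin.last D.T) h).symm))
  by_cases h0 : envWeight h = 0
  · rw [h0, zero_mul, zero_mul]
  · exact congrArg _ (Finset.prod_congr rfl fun i _ => hq i (Fin.last D.T) _ ⟨h, h0, rfl⟩ _)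

end Kuhn

/-! ### Isomorphisms -/

namespace Iso

variable {D : DecPOMDP.{u}} {E : DecPOMDP.{v}}

/-- The inverse of `f` as a bijection between the disjoint unions of the action sets. -/
def sigmaAct (f : Iso D E) : (Σ j, E.Act j) ≃ Σ i, D.Act i :=
  f.agent.symm.sigmaCongr fun j => (f.act j).symm

/-- The inverse of `f` as a bijection between the disjoint unions of the observation sets. -/
def sigmaObs (f : Iso D E) : (Σ j, E.Obs j) ≃ Σ i, D.Obs i :=
  f.agent.symm.sigmaCongr fun j => (f.obs j).symm

theorem ext_sigma {f g : Iso D E} (hagent : f.agent = g.agent) (hstate : f.state = g.state)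
    (hact : f.sigmaAct = g.sigmaAct) (hobs : f.sigmaObs = g.sigmaObs) : f = g := by
  obtain ⟨a, s, c, o, _, _, _, _, _⟩ := f
  obtain ⟨a', s', c', o', _, _, _, _, _⟩ := g
  obtain rfl : a = a' := hagent
  obtain rfl : s = s' := hstate
  have hc : c = c' := funext fun j => Equiv.symm_bijective.injective <| Equiv.ext fun y =>
    sigma_mk_injective (Equiv.congr_fun hact ⟨j, y⟩)
  have ho : o = o' := funext fun j => Equiv.symm_bijective.injective <| Equiv.ext fun y =>
    sigma_mk_injective (Equiv.congr_fun hobs ⟨j, y⟩)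
  subst hc ho
  rfl

/-- Composition of isomorphisms. -/
def trans {F : DecPOMDP} (f : Iso D E) (g : Iso E F) : Iso D F where
  agent := f.agent.trans g.agent
  state := f.state.trans g.state
  act := fun j => (f.act (g.agent.symm j)).trans (g.act j)
  obs := fun j => (f.obs (g.agent.symm j)).trans (g.obs j)
  horizon_eq := f.horizon_eq.trans g.horizon_eq
  map_P := fun s s' a => (f.map_P s s' a).trans (g.map_P _ _ _)
  map_O := fun s a o => (f.map_O s a o).trans (g.map_O _ _ _)
  map_R := fun s a => (f.map_R s a).trans (g.map_R _ _)
  map_b0 := fun s => (f.map_b0 s).trans (g.map_b0 _)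

theorem trans_left_injective {F : DecPOMDP} (g : Iso E F) :
    Function.Injective fun f : Iso D E => f.trans g := fun _ _ h =>
  ext_sigma
    (Equiv.ext fun x => g.agent.injective (Equiv.congr_fun (congrArg agent h) x))
    (Equiv.ext fun x => g.state.injective (Equiv.congr_fun (congrArg state h) x))
    (Equiv.ext <| g.sigmaAct.surjective.forall.2 <| Equiv.congr_fun (congrArg sigmaAct h))
    (Equiv.ext <| g.sigmaObs.surjective.forall.2 <| Equiv.congr_fun (congrArg sigmaObs h))

theorem trans_right_injective {F : DecPOMDP} (f : Iso D E) :
    Function.Injective fun g : Iso E F => f.trans g := fun _ _ h =>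
  ext_sigma
    (Equiv.ext <| f.agent.surjective.forall.2 <| Equiv.congr_fun (congrArg agent h))
    (Equiv.ext <| f.state.surjective.forall.2 <| Equiv.congr_fun (congrArg state h))
    (Equiv.ext fun x => f.sigmaAct.injective (Equiv.congr_fun (congrArg sigmaAct h) x))
    (Equiv.ext fun x => f.sigmaObs.injective (Equiv.congr_fun (congrArg sigmaObs h) x))

theorem piCongr'_symm_eq {ι κ : Type*} {X : ι → Type*} {Y : κ → Type*}
    (e : ι ≃ κ) (c : ∀ j, X (e.symm j) ≃ Y j) (y : ∀ j, Y j) :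
    e.symm.piCongr' (fun i => (c (e i)).symm.trans
      (Equiv.cast (congrArg X (e.symm_apply_apply i)))) y = (e.piCongr' c).symm y := by
  rw [Equiv.eq_symm_apply]
  funext j
  have hcast : ∀ (k : κ) (_ : k = j) (h' : X (e.symm k) = X (e.symm j)),
      c j (cast h' ((c k).symm (y k))) = y j := by
    rintro k rfl _
    exact (c k).apply_symm_apply (y k)
  exact hcast _ (e.apply_symm_apply j) _

/-- The inverse of an isomorphism. -/
def symm (f : Iso D E) : Iso E D where
  agent := f.agent.symm
  state := f.state.symm
  act := fun i => (f.act (f.agent i)).symm.trans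
    (Equiv.cast (congrArg D.Act (f.agent.symm_apply_apply i)))
  obs := fun i => (f.obs (f.agent i)).symm.trans
    (Equiv.cast (congrArg D.Obs (f.agent.symm_apply_apply i)))
  horizon_eq := f.horizon_eq.symm
  map_P := fun s s' a => by
    simp only [f.map_P, piCongr'_symm_eq, Equiv.apply_symm_apply]
  map_O := fun s a o => by
    simp only [f.map_O, piCongr'_symm_eq, Equiv.apply_symm_apply]
  map_R := fun s a => by
    simp only [f.map_R, piCongr'_symm_eq, Equiv.apply_symm_apply]
  map_b0 := fun s => by
    simp only [f.map_b0, Equiv.apply_symm_apply]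

theorem trans_left_bijective {F : DecPOMDP} (g : Iso E F) :
    Function.Bijective fun f : Iso D E => f.trans g :=
  (trans_left_injective g).bijective_of_nat_card_le
    (Nat.card_le_card_of_injective _ (trans_left_injective g.symm))

theorem trans_right_bijective {F : DecPOMDP} (f : Iso D E) :
    Function.Bijective fun g : Iso E F => f.trans g :=
  (trans_right_injective f).bijective_of_nat_card_le
    (Nat.card_le_card_of_injective _ (trans_right_injective f.symm))

end Iso

section Push

variable {D : DecPOMDP.{u}} {E : DecPOMDP.{v}}

/-- The action of an isomorphism on histories. -/
def histEquiv (f : Iso D E) (t : ℕ) : D.Hist t ≃ E.Hist t :=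
  ((Equiv.refl (Fin (t + 1))).arrowCongr f.state).prodCongr
    (((Equiv.refl (Fin (t + 1))).arrowCongr (f.agent.piCongr' f.act)).prodCongr
      ((Equiv.refl (Fin t)).arrowCongr (f.agent.piCongr' f.obs)))

/-- The local history `f⁻¹τ` of agent `f⁻¹j`. -/
def pullHist (f : Iso D E) {j : Fin E.N} {t : ℕ} (τ : E.LocalHist j t) :
    D.LocalHist (f.agent.symm j) t :=
  fun l => ((f.act j).symm (τ l).1, (f.obs j).symm (τ l).2)

theorem envWeight_histEquiv (f : Iso D E) {t : ℕ} (h : D.Hist t) :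
    envWeight (histEquiv f t h) = envWeight h := by
  unfold envWeight
  refine congr (congrArg _ (f.map_b0 _).symm) (Finset.prod_congr rfl fun k _ => ?_)
  rw [f.map_P, f.map_O]
  rfl

theorem pullHist_aoHist_histEquiv (f : Iso D E) {t : ℕ} (h : D.Hist t) (j : Fin E.N) :
    pullHist f (aoHist (histEquiv f t h) j t le_rfl) = aoHist h (f.agent.symm j) t le_rfl :=
  funext fun _ => Prod.ext ((f.act j).symm_apply_apply _) ((f.obs j).symm_apply_apply _)

theorem IsReachable.pullHist (f : Iso D E) {j : Fin E.N} {t : ℕ} {τ : E.LocalHist j t}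
    (hτ : IsReachable τ) : IsReachable (pullHist f τ) := by
  obtain ⟨h, h0, rfl⟩ := hτ
  obtain ⟨h, rfl⟩ := (histEquiv f t).surjective h
  rw [envWeight_histEquiv] at h0
  exact ⟨h, h0, (pullHist_aoHist_histEquiv f h j).symm⟩

theorem playActProb_push (f : Iso D E) (π : D.Policy) (j : Fin E.N) (t : Fin (E.T + 1))
    (τ : E.LocalHist j t) (a : E.Act j) :
    playActProb (push f π j) t τ a = playActProb (π (f.agent.symm j))
      (Fin.cast (congrArg (· + 1) f.horizon_eq.symm) t) (pullHist f τ) ((f.act j).symm a) :=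
  rfl

theorem histProb_push (f : Iso D E) (π : D.Policy) (t : Fin (E.T + 1)) (ht : t ≤ D.T)
    (h : D.Hist t) :
    histProb (push f π) t (Nat.le_of_lt_succ t.2) (histEquiv f t h) = histProb π t ht h := by
  rw [histProb_eq_envWeight_mul, envWeight_histEquiv]
  refine Eq.trans (congrArg _ (Fintype.prod_equiv f.agent.symm _ _ fun j => ?_))
    (histProb_eq_envWeight_mul π (Fin.cast (congrArg (· + 1) f.horizon_eq.symm) t) h).symm
  rw [playActProb_push]
  exact congr (congrArg _ (pullHist_aoHist_histEquiv f h j)) ((f.act j).symm_apply_apply _)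

theorem J_eq_sum_of_horizon (π : D.Policy) {t : ℕ} (ht : D.T = t) :
    D.J π = ∑ h : D.Hist t, histProb π t ht.ge h *
      ∑ k : Fin (t + 1), D.R (h.1 k) (h.2.1 k) := by
  subst ht
  rfl

theorem J_push (f : Iso D E) (π : D.Policy) : E.J (push f π) = D.J π := by
  rw [J_eq_sum_of_horizon π f.horizon_eq]
  refine (Fintype.sum_equiv (histEquiv f E.T) _ _ fun h => congrArg₂ (· * ·) ?_ ?_).symm
  · exact (histProb_push f π (Fin.last E.T) f.horizon_eq.ge h).symm
  · exact Finset.sum_congr rfl fun k _ => f.map_R _ _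

/-- The marginal of `μ` on the local policies of agent `i`. -/
noncomputable abbrev localMarginal (μ : ProbabilityMeasure D.Policy) (i : Fin D.N) :
    ProbabilityMeasure (D.LocalPolicy i) :=
  μ.map (measurable_pi_apply i).aemeasurable

theorem meanPlayActProb_localMarginal (μ : ProbabilityMeasure D.Policy) (i : Fin D.N)
    (t : Fin (D.T + 1)) (τ : D.LocalHist i t) (a : D.Act i) :
    meanPlayActProb (localMarginal μ i) t τ a =
      ∫ π, playActProb (π i) t τ a ∂(μ : Measure D.Policy) :=
  integral_map (measurable_pi_apply i).aemeasurable
    (measurable_playActProb t τ a).aestronglyMeasurable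

theorem Realizes.push (f : Iso D E) {π : D.Policy} {μ : ProbabilityMeasure D.Policy}
    {j : Fin E.N} (h : Realizes (π (f.agent.symm j)) (localMarginal μ (f.agent.symm j))) :
    Realizes (push f π j) (localMarginal (pushDist f μ) j) := by
  intro t τ hτ a
  rw [playActProb_push, h _ _ (hτ.pullHist f), meanPlayActProb_localMarginal,
    meanPlayActProb_localMarginal]
  exact (integral_map (measurable_push f).aemeasurable ((measurable_playActProb t τ a).comp
    (measurable_pi_apply j)).aestronglyMeasurable).symm

theorem pushDist_trans {F : DecPOMDP} (f : Iso D E) (g : Iso E F)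
    (μ : ProbabilityMeasure D.Policy) :
    pushDist (f.trans g) μ = pushDist g (pushDist f μ) :=
  ProbabilityMeasure.toMeasure_injective
    (Measure.map_map (measurable_push g) (measurable_push f)).symm

end Push

/-! ### Other-play -/

section OtherPlay

variable {D : DecPOMDP.{u}}

/-- The other-play return when every agent `k` uses its part of a joint policy `ρ k` of its own. -/
noncomputable def crossOP (D : DecPOMDP.{u}) (ρ : Fin D.N → D.Policy) : ℝ :=
  Finset.expect Finset.univ fun g : Fin D.N → D.Aut => D.J fun k => push (g k) (ρ k) k

theorem crossOP_const (π : D.Policy) : D.crossOP (fun _ => π) = D.JOP π :=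
  rfl

theorem opDist_eq_pi (π : D.Policy) :
    opDist π = ProbabilityMeasure.pi fun i =>
      uniformMixture fun g : D.Aut => diracProba (push g π i) :=
  (pi_uniformMixture_diracProba fun i (g : D.Aut) => push g π i).symm

theorem localMarginal_opDist (π : D.Policy) (i : Fin D.N) :
    localMarginal (opDist π) i = uniformMixture fun g : D.Aut => diracProba (push g π i) := by
  rw [opDist_eq_pi]
  exact ProbabilityMeasure.toMeasure_injective (measurePreserving_eval _ i).map_eq

theorem crossOP_eq_J_symmetrizer (ρ : Fin D.N → D.Policy) :
    D.crossOP ρ = D.J fun k => symmetrizer (ρ k) k := by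
  have hmix (k : Fin D.N) : Realizes (symmetrizer (ρ k) k)
      (uniformMixture fun g : D.Aut => diracProba (push g (ρ k) k)) :=
    localMarginal_opDist (ρ k) k ▸ realizes_localMixture _
  rw [J_eq_integral_pi_of_realizes hmix, ← ProbabilityMeasure.toMeasure_pi,
    pi_uniformMixture_diracProba fun k (g : D.Aut) => push g (ρ k) k,
    integral_uniformMixture _ fun g => integrable_J _]
  exact Finset.expect_congr rfl fun g _ =>
    (integral_dirac' _ _ D.measurable_J.stronglyMeasurable).symm

theorem crossOP_push {E : DecPOMDP.{v}} (f : Iso D E) (ρ : Fin D.N → D.Policy) :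
    E.crossOP (fun j => push f (ρ (f.agent.symm j))) = D.crossOP ρ := by
  trans Finset.expect Finset.univ fun h : Fin E.N → Iso D E =>
    E.J fun j => push (h j) (ρ (f.agent.symm j)) j
  · exact Fintype.expect_bijective (fun (g : Fin E.N → E.Aut) j => f.trans (g j))
      (Function.Bijective.piMap fun _ => Iso.trans_right_bijective f) _ _ fun g => rfl
  · refine (Fintype.expect_bijective (fun (g : Fin D.N → D.Aut) j =>
      (g (f.agent.symm j)).trans f) ?_ _ _ fun g => ?_).symm
    · exact (Function.Bijective.piMap (f := fun _ : Fin E.N => fun g : D.Aut => g.trans f)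
        fun _ => Iso.trans_left_bijective f).comp
          (f.agent.symm.arrowCongr (Equiv.refl D.Aut)).symm.bijective
    · rw [← J_push f]
      rfl

theorem JOP_push {E : DecPOMDP.{v}} (f : Iso D E) (π : D.Policy) : E.JOP (push f π) = D.JOP π :=
  crossOP_push f fun _ => π

theorem push_mem_opOptimal {E : DecPOMDP.{v}} (f : Iso D E) {π : D.Policy}
    (hπ : π ∈ D.opOptimal) : push f π ∈ E.opOptimal := fun π' => by
  rw [JOP_push, ← JOP_push f.symm]
  exact hπ _

end OtherPlay

/-! ### The label-free coordination game -/

section LFCGame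

variable {D : DecPOMDP.{u}}

instance : Nonempty D.Labeling :=
  ⟨{ agent := Equiv.refl _, state := Fintype.equivFin _, act := fun _ => Fintype.equivFin _,
     obs := fun _ => Fintype.equivFin _ }⟩

instance : Nonempty D.relabelings :=
  (Set.range_nonempty D.relabel).to_subtype

/-- A labeling as an isomorphism onto the relabeled problem. -/
def Labeling.toIso (f : D.Labeling) : Iso D (D.relabel f) where
  agent := f.agent
  state := f.state
  act := fun i => f.act (f.agent.symm i)
  obs := fun i => f.obs (f.agent.symm i)
  horizon_eq := rfl
  map_P := fun s s' a => by
    change _ = D.P (f.state.symm (f.state s)) (f.jointAct.symm (f.jointAct a))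
      (f.state.symm (f.state s'))
    simp only [Equiv.symm_apply_apply]
  map_O := fun s a o => by
    change _ = D.O (f.state.symm (f.state s)) (f.jointAct.symm (f.jointAct a))
      (f.jointObs.symm (f.jointObs o))
    simp only [Equiv.symm_apply_apply]
  map_R := fun s a => by
    change _ = D.R (f.state.symm (f.state s)) (f.jointAct.symm (f.jointAct a))
    simp only [Equiv.symm_apply_apply]
  map_b0 := fun s => by
    change _ = D.b0 (f.state.symm (f.state s))
    simp only [Equiv.symm_apply_apply]

instance (E : D.relabelings) : Nonempty (Iso E.1 D) := by
  obtain ⟨_, f, rfl⟩ := E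
  exact ⟨f.toIso.symm⟩

/-- The distribution over joint policies of `D` induced by a principal who uses `σ`: a relabeled
problem `E` and an isomorphism from `E` to `D` are drawn uniformly, then a policy from `σ E`. -/
noncomputable def principalDist (σ : LearningAlg D.relabelings) : ProbabilityMeasure D.Policy :=
  uniformMixture fun E : D.relabelings => uniformMixture fun f : Iso E.1 D => pushDist f (σ E)

theorem pushDist_principalDist (g : D.Aut) (σ : LearningAlg D.relabelings) :
    pushDist g (principalDist σ) = principalDist σ := by
  unfold principalDist
  refine (uniformMixture_map _ (measurable_push g)).trans (congrArg _ (funext fun E => ?_))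
  refine (uniformMixture_map _ (measurable_push g)).trans ?_
  rw [← uniformMixture_comp (fun f => pushDist f (σ E)) (Iso.trans_left_bijective g)]
  exact congrArg _ (funext fun f => (pushDist_trans f g (σ E)).symm)

theorem integrable_J_comp {X : Type*} [MeasurableSpace X] (m : Measure X) [IsFiniteMeasure m]
    {G : X → D.Policy} (hG : Measurable G) : Integrable (fun x => D.J (G x)) m :=
  (integrable_J (m.map G)).comp_measurable hG

theorem measurable_diag : Measurable fun (π : Fin D.N → D.Policy) l => π l l :=
  measurable_pi_lambda _ fun l => (measurable_pi_apply l).comp (measurable_pi_apply l)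

theorem integral_pi_principalDist (σ : Fin D.N → LearningAlg D.relabelings)
    {F : (Fin D.N → D.Policy) → ℝ}
    (hF : ∀ m : ProbabilityMeasure (Fin D.N → D.Policy), Integrable F (m : Measure _)) :
    ∫ π, F π ∂(Measure.pi fun k => (principalDist (σ k) : Measure D.Policy)) =
      Finset.expect Finset.univ fun Ds : Fin D.N → D.relabelings =>
        Finset.expect Finset.univ fun f : ((j : Fin D.N) → Iso (Ds j).1 D) =>
          ∫ π, F π ∂(Measure.pi fun k => (pushDist (f k) (σ k (Ds k)) : Measure D.Policy)) := by
  unfold principalDist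
  rw [← ProbabilityMeasure.toMeasure_pi, pi_uniformMixture fun k (E : D.relabelings) =>
    uniformMixture fun f : Iso E.1 D => pushDist f (σ k E), integral_uniformMixture _ fun _ => hF _]
  refine Finset.expect_congr rfl fun Ds _ => ?_
  rw [pi_uniformMixture fun k (f : Iso (Ds k).1 D) => pushDist f (σ k (Ds k)),
    integral_uniformMixture _ fun _ => hF _]
  rfl

theorem payoff_eq_integral (σ : Fin D.N → LearningAlg D.relabelings) :
    D.payoff σ = ∫ π : Fin D.N → D.Policy, D.J (fun l => π l l)
      ∂(Measure.pi fun k => (principalDist (σ k) : Measure D.Policy)) :=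
  (integral_pi_principalDist σ fun _ => integrable_J_comp _ measurable_diag).symm

theorem payoff_eq_integral_pi_localMarginal (σ : Fin D.N → LearningAlg D.relabelings) :
    D.payoff σ = ∫ π, D.J π
      ∂(Measure.pi fun k => (localMarginal (principalDist (σ k)) k : Measure (D.LocalPolicy k))) :=
  (payoff_eq_integral σ).trans
    (integral_pi_map (fun k => principalDist (σ k)) (f := fun k π => π k)
      (fun k => measurable_pi_apply k) D.measurable_J.aestronglyMeasurable).symm

theorem payoff_mem_range_JOP {σ : Fin D.N → LearningAlg D.relabelings}
    (hσ : D.IsSymmetricProfile σ) : D.payoff σ ∈ Set.range D.JOP := by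
  let μ i := localMarginal (principalDist (σ i)) i
  let q : D.Policy := fun i => localMixture i (μ i)
  have hq (g : Fin D.N → D.Aut) (i : Fin D.N) : Realizes (profilePush g q i) (μ i) := by
    have h : Realizes (q ((g i).agent.symm i))
        (localMarginal (principalDist (σ i)) ((g i).agent.symm i)) := by
      rw [hσ (g i) i]
      exact realizes_localMixture _
    have := h.push (g i)
    rwa [pushDist_principalDist] at this
  refine ⟨q, (Finset.expect_congr rfl fun g _ => ?_).trans (Fintype.expect_const (D.payoff σ))⟩
  rw [J_eq_integral_pi_of_realizes (hq g), payoff_eq_integral_pi_localMarginal]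

theorem measurable_push_diag (g : Fin D.N → D.Aut) :
    Measurable fun (ρ : Fin D.N → D.Policy) k => push (g k) (ρ k) k :=
  measurable_pi_lambda _ fun k =>
    (measurable_pi_apply k).comp ((measurable_push (g k)).comp (measurable_pi_apply k))

theorem integrable_crossOP (m : Measure (Fin D.N → D.Policy)) [IsFiniteMeasure m] :
    Integrable D.crossOP m :=
  integrable_expect fun g => integrable_J_comp m (measurable_push_diag g)

theorem payoff_eq_integral_crossOP (σ : Fin D.N → LearningAlg D.relabelings) :
    D.payoff σ = ∫ ρ, D.crossOP ρ
      ∂(Measure.pi fun k => (principalDist (σ k) : Measure D.Policy)) := by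
  unfold crossOP
  rw [integral_expect fun g => integrable_J_comp _ (measurable_push_diag g)]
  refine ((Finset.expect_congr rfl fun g _ => ?_).trans (Fintype.expect_const _)).symm
  rw [payoff_eq_integral]
  refine (integral_pi_map (fun k => principalDist (σ k)) (fun k => measurable_push (g k))
    (integrable_J_comp _ measurable_diag).aestronglyMeasurable).symm.trans ?_
  change ∫ π, _ ∂(Measure.pi fun k => (pushDist (g k) (principalDist (σ k)) : Measure D.Policy)) = _
  simp only [pushDist_principalDist]

end LFCGame

/-! ### Tie-breaking -/

section TieBreaking

theorem symmetrizer_push_eq {C : Set DecPOMDP.{u}} {χ : (E : C) → E.1.Policy → Set.Icc (0 : ℝ) 1}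
    (hχ : IsTieBreaking C χ) (hχ_inv : IsIsoInvariant C χ) {E F : C} (f : Iso E.1 F.1)
    {π : E.1.Policy} {ρ : F.1.Policy} (hπ : π ∈ E.1.opOptimal)
    (hπ_max : IsMaxOn (χ E) E.1.opOptimal π) (hρ : ρ ∈ F.1.opOptimal)
    (hρ_max : IsMaxOn (χ F) F.1.opOptimal ρ) :
    symmetrizer (push f π) = symmetrizer ρ := by
  have hχπ : χ E π = χ F (push f π) := hχ_inv E F f π _ rfl
  have hχρ : χ F ρ = χ E (push f.symm ρ) := hχ_inv F E f.symm ρ _ rfl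
  refine hχ.2 F _ _ (le_antisymm (hρ_max (push_mem_opOptimal f hπ)) ?_)
  rw [hχρ, ← hχπ]
  exact hπ_max (push_mem_opOptimal f.symm hρ)

theorem IsOPWithTieBreaking.ae_isMaxOn {C : Set DecPOMDP.{u}}
    {χ : (E : C) → E.1.Policy → Set.Icc (0 : ℝ) 1} {σ : LearningAlg C}
    (hσ : IsOPWithTieBreaking C χ σ) (E : C) :
    ∀ᵐ π ∂(σ E : Measure E.1.Policy), π ∈ E.1.opOptimal ∧ IsMaxOn (χ E) E.1.opOptimal π := by
  obtain ⟨Z, hZ, hZ_opt, hZ_one, hZ_max⟩ := hσ E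
  filter_upwards [(mem_ae_iff_prob_eq_one hZ).2 hZ_one] with π hπ
  exact ⟨hZ_opt hπ, hZ_max π hπ⟩

variable {D : DecPOMDP.{u}} {χ : (E : D.relabelings) → E.1.Policy → Set.Icc (0 : ℝ) 1}

theorem crossOP_push_eq_JOP (hχ : IsTieBreaking D.relabelings χ)
    (hχ_inv : IsIsoInvariant D.relabelings χ) {E : D.relabelings} (r : Iso D E.1)
    {π₀ : E.1.Policy} (hπ₀ : π₀ ∈ E.1.opOptimal) (hπ₀_max : IsMaxOn (χ E) E.1.opOptimal π₀)
    {Ds : Fin D.N → D.relabelings} (f : ∀ k, Iso (Ds k).1 D) {π : ∀ k, (Ds k).1.Policy}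
    (hπ : ∀ k, π k ∈ (Ds k).1.opOptimal ∧ IsMaxOn (χ (Ds k)) (Ds k).1.opOptimal (π k)) :
    D.crossOP (fun k => push (f k) (π k)) = E.1.JOP π₀ := by
  rw [← crossOP_push r, ← crossOP_const, crossOP_eq_J_symmetrizer, crossOP_eq_J_symmetrizer]
  refine congrArg _ (funext fun j => congrFun ?_ j)
  exact symmetrizer_push_eq hχ hχ_inv ((f (r.agent.symm j)).trans r) (hπ _).1 (hπ _).2 hπ₀ hπ₀_max

theorem IsOPWithTieBreaking.payoff_eq_JOP {σ : LearningAlg D.relabelings}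
    (hσ : IsOPWithTieBreaking D.relabelings χ σ) (hχ : IsTieBreaking D.relabelings χ)
    (hχ_inv : IsIsoInvariant D.relabelings χ) {E : D.relabelings} (r : Iso D E.1)
    {π₀ : E.1.Policy} (hπ₀ : π₀ ∈ E.1.opOptimal) (hπ₀_max : IsMaxOn (χ E) E.1.opOptimal π₀) :
    D.payoff (fun _ => σ) = E.1.JOP π₀ := by
  rw [payoff_eq_integral_crossOP, integral_pi_principalDist _ fun _ => integrable_crossOP _]
  refine (Finset.expect_congr rfl fun Ds _ => (Finset.expect_congr rfl fun f _ => ?_).trans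
    (Fintype.expect_const _)).trans (Fintype.expect_const _)
  refine (integral_pi_map (fun k => σ (Ds k)) (fun k => measurable_push (f k))
    (integrable_crossOP _).aestronglyMeasurable).trans ?_
  have hae : ∀ᵐ π ∂(Measure.pi fun k => (σ (Ds k) : Measure (Ds k).1.Policy)),
      D.crossOP (fun k => push (f k) (π k)) = E.1.JOP π₀ := by
    filter_upwards [Filter.eventually_all.2 fun k =>
      Measure.tendsto_eval_ae_ae.eventually (hσ.ae_isMaxOn (Ds k))] with π hπ
    exact crossOP_push_eq_JOP hχ hχ_inv r hπ₀ hπ₀_max f hπ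
  rw [integral_congr_ae hae, integral_const, probReal_univ, one_smul]

theorem IsOPWithTieBreaking.isGreatest_payoff {σ : LearningAlg D.relabelings}
    (hσ : IsOPWithTieBreaking D.relabelings χ σ) (hχ : IsTieBreaking D.relabelings χ)
    (hχ_inv : IsIsoInvariant D.relabelings χ) :
    IsGreatest (Set.range D.JOP) (D.payoff fun _ => σ) := by
  obtain ⟨E⟩ : Nonempty D.relabelings := inferInstance
  obtain ⟨r⟩ : Nonempty (Iso E.1 D) := inferInstance
  obtain ⟨π₀, hπ₀, hπ₀_max⟩ := hχ.1 E
  rw [hσ.payoff_eq_JOP hχ hχ_inv r.symm hπ₀ hπ₀_max, ← JOP_push r]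
  exact ⟨Set.mem_range_self _, Set.forall_mem_range.2 (push_mem_opOptimal r hπ₀)⟩

end TieBreaking

end DecPOMDP

theorem mainTheorem1 (D : DecPOMDP.{u})
    (χ : (E : D.relabelings) → E.1.Policy → Set.Icc (0 : ℝ) 1)
    (hχ : DecPOMDP.IsTieBreaking D.relabelings χ)
    (hχ_inv : DecPOMDP.IsIsoInvariant D.relabelings χ)
    (σχ : DecPOMDP.LearningAlg D.relabelings)
    (hσχ : DecPOMDP.IsOPWithTieBreaking D.relabelings χ σχ) :
    D.IsOptimalSymmetricProfile (fun _ => σχ) ∧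
    D.IsLFCOptimal σχ ∧
    IsGreatest (Set.range D.lfcValue) (D.lfcValue σχ) ∧
    IsGreatest (Set.range D.JOP) (D.lfcValue σχ) := by
  have hval : IsGreatest (Set.range D.JOP) (D.lfcValue σχ) := hσχ.isGreatest_payoff hχ hχ_inv
  have hsym (σ : Fin D.N → DecPOMDP.LearningAlg D.relabelings) (hσ : D.IsSymmetricProfile σ) :
      D.payoff σ ≤ D.lfcValue σχ :=
    hval.2 (DecPOMDP.payoff_mem_range_JOP hσ)
  have hopt : D.IsLFCOptimal σχ := fun σ => hsym (fun _ => σ) fun _ _ => rfl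
  exact ⟨⟨fun _ _ => rfl, hsym⟩, hopt,
    ⟨Set.mem_range_self σχ, Set.forall_mem_range.2 hopt⟩, hval⟩
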